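/- Fix a number $k\ge 1$ of arms. There is a constant $C>0$, depending only on $k$, such that the following holds for all means $\mu=(\mu_1,\dots,\mu_k)\in[0,1]^k$, all fairness vectors $r=(r_1,\dots,r_k)\in[0,1/k)^k$, every unfairness tolerance $\alpha\ge 0$ and every time $T\ge 2$. The successive pulls of arm $i$ yield i.i.d. $\mathrm{Bernoulli}(\mu_i)$ rewards, and the rewards of different arms are independent. Let $N_{i,t}$ be the number of pulls of arm $i$ in rounds $1,\dots,t$ and $S_{i,t}$ the total reward collected from arm $i$ in these rounds. The algorithm Fair-UCB proceeds in each round $t=1,2,\dots$ as follows. If $r_j(t-1)-N_{j,t-1}>\alpha$ for some arm $j$, it pulls an arm $i$ that maximizes $r_i(t-1)-N_{i,t-1}$. Otherwise it follows UCB1: it pulls an arm that has never been pulled, if there is one, and else an arm $i$ that maximizes $$\frac{S_{i,t-1}}{N_{i,t-1}}+\sqrt{\frac{2\ln t}{N_{i,t-1}}}.$$ Ties are broken arbitrarily. Then, with $\Delta_i=\max_j\mu_j-\mu_i$, the $r$-Regret $$\mathcal R^{r}(T)=\sum_{i=1}^k \Delta_i\Big(\mathbb E[N_{i,T}]-\max\big(0,\lfloor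 r_iT\rfloor-\alpha\big)\Big)$$ of Fair-UCB satisfies $$\mathcal R^{r}(T)\le C\sqrt{T\ln T}.$$ That is, the distribution-free (worst case over instances) $r$-Regret of Fair-UCB is $O(\sqrt{T\ln T})$. -/

import Mathlib

open MeasureTheory ProbabilityTheory

noncomputable section

namespace FairMAB

variable {k : ℕ}

/-- `pulls a i t` is the number of rounds among `1, …, t` in which arm `i` is pulled, when
`a s` is the arm pulled in round `s` (the value `a 0` is never used). -/
def pulls (a : ℕ → Fin k) (i : Fin k) (t : ℕ) : ℕ :=
  ((Finset.Icc 1 t).filter (fun s => a s = i)).card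

/-- `totalReward x a i t` is the total reward collected from arm `i` in rounds `1, …, t`, where
`x i n` is the reward given by the `(n + 1)`-st pull of arm `i`. -/
def totalReward (x : Fin k → ℕ → ℝ) (a : ℕ → Fin k) (i : Fin k) (t : ℕ) : ℝ :=
  ∑ n ∈ Finset.range (pulls a i t), x i n

/-- A learning algorithm, up to tie-breaking: from the round `t`, the numbers of pulls and the
total rewards of all arms before round `t`, it gives the set of arms that it may pull. -/
abbrev Learner (k : ℕ) : Type :=
  ℕ → (Fin k → ℕ) → (Fin k → ℝ) → Set (Fin k)

/-- The UCB1 estimate, in round `t`, of the mean of an arm which has been pulled `n ≥ 1` times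
with total reward `s`. -/
def ucbIndex (t n : ℕ) (s : ℝ) : ℝ :=
  s / n + Real.sqrt (2 * Real.log t / n)

/-- UCB1: as long as some arm has never been pulled, pull such an arm;
afterwards pull an arm with the largest UCB1 estimate. -/
def ucb1 : Learner k := fun t N S =>
  {i | ((∃ j, N j = 0) → N i = 0) ∧
    ((∀ j, N j ≠ 0) → ∀ j, ucbIndex t (N j) (S j) ≤ ucbIndex t (N i) (S i))}

/-- Fair-Learn with fairness vector `r`, unfairness tolerance `α` and learning algorithm `L`:
if `r j * (t - 1) - N j > α` for some arm `j`, pull an arm that maximizes this difference;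
otherwise do as `L` does. -/
def fairLearn (r : Fin k → ℝ) (α : ℝ) (L : Learner k) : Learner k := fun t N S =>
  {i | ((∃ j, α < r j * ((t : ℝ) - 1) - N j) →
      ∀ j, r j * ((t : ℝ) - 1) - N j ≤ r i * ((t : ℝ) - 1) - N i) ∧
    ((¬ ∃ j, α < r j * ((t : ℝ) - 1) - N j) → i ∈ L t N S)}

/-- `a` is the sequence of arms of a run of the algorithm `L` (with any tie-breaking) on the
rewards `x`: in every round `t ≥ 1` the arm is one that `L` allows after the first `t - 1`
rounds. -/
def IsRun (L : Learner k) (x : Fin k → ℕ → ℝ) (a : ℕ → Fin k) : Prop :=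
  ∀ t : ℕ, 1 ≤ t →
    a t ∈ L t (fun i => pulls a i (t - 1)) (fun i => totalReward x a i (t - 1))

/-- The rewards of a stochastic bandit with Bernoulli arms of means `μ`: the successive rewards
`X i 0, X i 1, …` of each arm `i` have law `Bernoulli (μ i)`, and all rewards are independent. -/
structure IsBernoulliBandit {Ω : Type*} [MeasurableSpace Ω] (P : Measure Ω)
    (μ : Fin k → unitInterval) (X : Fin k → ℕ → Ω → ℝ) : Prop where
  hasLaw : ∀ i n, HasLaw (X i n) (bernoulliMeasure (1 : ℝ) 0 (μ i)) P
  indep : iIndepFun (fun p : Fin k × ℕ => X p.1 p.2) P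

/-- The gap `Δ_i` between the largest mean and the mean of arm `i`. -/
def gap (μ : Fin k → unitInterval) (i : Fin k) : ℝ :=
  (⨆ j, (μ j : ℝ)) - μ i

/-- The fairness-aware `r`-Regret after `T` rounds, for the (random) arms `a t` pulled in
rounds `t = 1, 2, …`. -/
def rRegret {Ω : Type*} [MeasurableSpace Ω] (P : Measure Ω) (μ : Fin k → unitInterval)
    (r : Fin k → ℝ) (α : ℝ) (a : ℕ → Ω → Fin k) (T : ℕ) : ℝ :=
  ∑ i, gap μ i *
    ((∫ ω, (pulls (fun t => a t ω) i T : ℝ) ∂P) - max 0 ((⌊r i * (T : ℝ)⌋ : ℝ) - α))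

end FairMAB

end

namespace FairMAB

open Finset

variable {k : ℕ}

/-! Fix a run and an arm `i` with gap Δ > 0. A pull of `i` is forced by fairness, is its first pull,
or is a UCB1 choice. A forced pull needs N_i < r_i T - α; a UCB1 choice made while the confidence
bounds hold needs N_i ≤ 8 log T / Δ² (`pulls_le_of_isRun`). Hoeffding's inequality bounds the
probability that they fail in round t by 2/t², which is summable. Hence the excess of E[N_i] over
max(0, ⌊r_i T⌋ - α) is at most 2 + 2K + 8 log T / Δ², where K = ∑ 1/s² (`integral_pulls_le`). It is
also at most T; using the latter for Δ ≤ √(log T / T) and the former otherwise, each arm contributes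
O(√(T log T)). -/

lemma pulls_zero (a : ℕ → Fin k) (i : Fin k) : pulls a i 0 = 0 := by
  simp [pulls]

lemma pulls_succ (a : ℕ → Fin k) (i : Fin k) (t : ℕ) :
    pulls a i (t + 1) = pulls a i t + if a (t + 1) = i then 1 else 0 := by
  unfold pulls
  rw [← Finset.insert_Icc_right_eq_Icc_add_one (by omega), Finset.filter_insert]
  split_ifs <;> simp

lemma pulls_le (a : ℕ → Fin k) (i : Fin k) (t : ℕ) : pulls a i t ≤ t := by
  unfold pulls
  exact (Finset.card_filter_le _ _).trans (by simp)

lemma measurable_pulls {Ω : Type*} [MeasurableSpace Ω] {a : ℕ → Ω → Fin k}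
    (ha : ∀ t, Measurable (a t)) (i : Fin k) (t : ℕ) :
    Measurable (fun ω => (pulls (fun s => a s ω) i t : ℝ)) := by
  induction t with
  | zero => simp [pulls_zero]
  | succ t ih =>
    simp only [pulls_succ, Nat.cast_add]
    refine ih.add ?_
    have : (fun ω => (((if a (t + 1) ω = i then 1 else 0 : ℕ)) : ℝ))
        = (fun j : Fin k => (((if j = i then 1 else 0 : ℕ)) : ℝ)) ∘ a (t + 1) := rfl
    rw [this]
    exact (measurable_of_finite _).comp (ha _)

/-- If the empirical means of arm `i` and of a better arm `j` are within their confidence radii,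
then UCB1 prefers `i` to `j` only if `i` has been pulled few times. -/
lemma pulls_le_of_ucbIndex_le {t n m : ℕ} (hn : 0 < n) (hm : 0 < m)
    {p q s u : ℝ} (hpq : p < q)
    (hs : s - n * p < √(2 * n * Real.log t)) (hu : m * q - u < √(2 * m * Real.log t))
    (h : ucbIndex t m u ≤ ucbIndex t n s) :
    (n : ℝ) ≤ 8 * Real.log t / (q - p) ^ 2 := by
  have hlog : 0 ≤ Real.log t := Real.log_natCast_nonneg t
  have key : ∀ {l : ℕ}, 0 < l → √(2 * l * Real.log t) = l * √(2 * Real.log t / l) := by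
    intro l hl
    have hl' : (0 : ℝ) < l := by exact_mod_cast hl
    rw [show 2 * (l : ℝ) * Real.log t = (l : ℝ) ^ 2 * (2 * Real.log t / l) by field_simp,
      Real.sqrt_mul (by positivity), Real.sqrt_sq hl'.le]
  have hn' : (0 : ℝ) < n := by exact_mod_cast hn
  have hm' : (0 : ℝ) < m := by exact_mod_cast hm
  rw [key hn] at hs
  rw [key hm] at hu
  unfold ucbIndex at h
  have h1 : s / n < p + √(2 * Real.log t / n) := by
    rw [div_lt_iff₀ hn']; linarith
  have h2 : q - √(2 * Real.log t / m) < u / m := by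
    rw [lt_div_iff₀ hm']; linarith
  -- The radius of the better arm cancels: q < u/m + radius(m) ≤ s/n + radius(n) < p + 2 radius(n).
  have h3 : q - p < 2 * √(2 * Real.log t / n) := by linarith
  have h4 : (q - p) ^ 2 ≤ (2 * √(2 * Real.log t / n)) ^ 2 :=
    pow_le_pow_left₀ (by linarith) h3.le 2
  rw [mul_pow, Real.sq_sqrt (by positivity)] at h4
  rw [le_div_iff₀ (by have := sub_pos.2 hpq; positivity)]
  calc (n : ℝ) * (q - p) ^ 2 ≤ n * (2 ^ 2 * (2 * Real.log t / n)) := by gcongr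
    _ = 8 * Real.log t := by
      field_simp
      ring

/-- Along a run of Fair-UCB, a suboptimal arm `i` is pulled at most about as often as fairness
requires, or `8 log T / Δ ^ 2` times, up to the rounds in which confidence bounds fail. -/
lemma pulls_le_of_isRun {r : Fin k → ℝ} {α : ℝ} {x : Fin k → ℕ → ℝ} {a : ℕ → Fin k}
    (hrun : IsRun (fairLearn r α ucb1) x a) {i j : Fin k} (hri : 0 ≤ r i)
    {μ : Fin k → ℝ} (hμ : μ i < μ j) {B : Set ℕ}
    (hB : ∀ t, 1 ≤ t → t ∉ B → ∀ n ∈ Icc 1 t,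
      ∑ m ∈ range n, (x i m - μ i) < √(2 * n * Real.log t) ∧
      ∑ m ∈ range n, (μ j - x j m) < √(2 * n * Real.log t))
    {t T : ℕ} (htT : t ≤ T) :
    (pulls a i t : ℝ) ≤ max 0 ((⌊r i * (T : ℝ)⌋ : ℝ) - α) + 2
      + 8 * Real.log T / (μ j - μ i) ^ 2 + ∑ s ∈ Icc 1 t, B.indicator 1 s := by
  have hL : 0 ≤ 8 * Real.log T / (μ j - μ i) ^ 2 := by
    have := Real.log_natCast_nonneg T
    positivity
  have hM := le_max_left 0 ((⌊r i * (T : ℝ)⌋ : ℝ) - α)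
  have hind : ∀ s, 0 ≤ B.indicator (1 : ℕ → ℝ) s :=
    fun s => Set.indicator_nonneg (fun _ _ => zero_le_one) s
  have hsum : ∀ t, 0 ≤ ∑ s ∈ Icc 1 t, B.indicator (1 : ℕ → ℝ) s :=
    fun t => Finset.sum_nonneg fun s _ => hind s
  induction t with
  | zero =>
    have := hsum 0
    simp only [pulls_zero, Nat.cast_zero]
    linarith
  | succ t ih =>
    specialize ih (by omega)
    have hS : ∑ s ∈ Icc 1 (t + 1), B.indicator (1 : ℕ → ℝ) s
        = ∑ s ∈ Icc 1 t, B.indicator 1 s + B.indicator 1 (t + 1) :=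
      Finset.sum_Icc_succ_top (by omega) _
    have h0 := hsum t
    have h1 := hind (t + 1)
    rw [pulls_succ, hS]
    split_ifs with hi
    swap
    · push_cast; linarith
    push_cast
    obtain ⟨hfair, hucb⟩ := hrun (t + 1) (by omega)
    simp only [hi, Nat.add_sub_cancel, Nat.cast_add, Nat.cast_one, add_sub_cancel_right]
      at hfair hucb
    by_cases hf : ∃ j, α < r j * (t : ℝ) - pulls a j t
    -- The maximizer `i` itself lags by more than α. The constant 2 pays for the floor and for the
    -- present pull.
    · obtain ⟨l, hl⟩ := hf
      have h2 := hl.trans_le (hfair ⟨l, hl⟩ l)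
      have h3 : r i * (t : ℝ) ≤ r i * T := by
        gcongr; omega
      have h4 := Int.lt_floor_add_one (r i * (T : ℝ))
      have h5 := le_max_right 0 ((⌊r i * (T : ℝ)⌋ : ℝ) - α)
      linarith
    · obtain ⟨hnew, hind'⟩ := hucb hf
      by_cases hz : ∃ l, pulls a l t = 0
      · have hz' : pulls a i t = 0 := hnew hz
        rw [hz', Nat.cast_zero]
        linarith
      · push Not at hz
        by_cases hb : t + 1 ∈ B
        -- A bad round pays for its own pull; only this case and the one without a pull use the
        -- induction hypothesis.
        · rw [Set.indicator_of_mem hb, Pi.one_apply]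
          linarith
        · have hle := hind' hz j
          have hni : 0 < pulls a i t := Nat.pos_of_ne_zero (hz i)
          have hnj : 0 < pulls a j t := Nat.pos_of_ne_zero (hz j)
          have hi1 := (hB (t + 1) (by omega) hb (pulls a i t)
            (Finset.mem_Icc.2 ⟨hni, (pulls_le a i t).trans (by omega)⟩)).1
          have hj1 := (hB (t + 1) (by omega) hb (pulls a j t)
            (Finset.mem_Icc.2 ⟨hnj, (pulls_le a j t).trans (by omega)⟩)).2
          rw [Finset.sum_sub_distrib, Finset.sum_const, Finset.card_range, nsmul_eq_mul]
            at hi1 hj1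
          have h6 := pulls_le_of_ucbIndex_le hni hnj hμ hi1 hj1 hle
          have h7 : 8 * Real.log (t + 1 : ℕ) / (μ j - μ i) ^ 2
              ≤ 8 * Real.log T / (μ j - μ i) ^ 2 := by
            gcongr
          linarith

section Concentration

variable {Ω : Type*} [MeasurableSpace Ω] {P : Measure Ω} [IsProbabilityMeasure P]
  {μ : Fin k → unitInterval} {X : Fin k → ℕ → Ω → ℝ}

/-- Hoeffding's lemma on [0, 1]; the parameter is the squared half-width 1/4. -/
lemma IsBernoulliBandit.hasSubgaussianMGF (h : IsBernoulliBandit P μ X) (i : Fin k) (n : ℕ) :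
    HasSubgaussianMGF (fun ω => X i n ω - μ i) (1 / 4) P := by
  have hb : ∀ᵐ ω ∂P, X i n ω ∈ Set.Icc (0 : ℝ) 1 := by
    rw [(h.hasLaw i n).ae_iff (p := fun y => y ∈ Set.Icc (0 : ℝ) 1)
      (by exact measurableSet_Icc.mem), ae_iff]
    exact bernoulliMeasure_apply_of_notMem_of_notMem _
      (measurableSet_Icc (a := (0 : ℝ)) (b := 1)).compl (by simp) (by simp)
  have hmean : ∫ ω, X i n ω ∂P = μ i := by
    rw [(h.hasLaw i n).integral_eq, integral_bernoulliMeasure]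
    simp
  have := hasSubgaussianMGF_of_mem_Icc (h.hasLaw i n).aemeasurable hb
  rw [hmean] at this
  convert this using 1
  ext
  norm_num

/-- Rewards of arm `i` deviate from their mean, after some number `n ≤ t` of pulls, upwards
by at least the confidence radius of round `t`. -/
def exceeds (μ : Fin k → unitInterval) (X : Fin k → ℕ → Ω → ℝ) (i : Fin k) (t : ℕ) : Set Ω :=
  ⋃ n ∈ Icc 1 t, {ω | √(2 * n * Real.log t) ≤ ∑ m ∈ range n, (X i m ω - μ i)}

/-- The downward analogue of `exceeds`. -/
def fallsShort (μ : Fin k → unitInterval) (X : Fin k → ℕ → Ω → ℝ) (i : Fin k) (t : ℕ) : Set Ω :=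
  ⋃ n ∈ Icc 1 t, {ω | √(2 * n * Real.log t) ≤ ∑ m ∈ range n, (μ i - X i m ω)}

-- The number of pulls is random, so all n ≤ t are covered by a union bound; each has probability at
-- most exp(-4 log t) = t⁻⁴.
omit [IsProbabilityMeasure P] in
lemma measureReal_biUnion_sum_ge_le {Y : ℕ → Ω → ℝ} (hY : iIndepFun Y P)
    (hsub : ∀ n, HasSubgaussianMGF (Y n) (1 / 4) P) {t : ℕ} (ht : 1 ≤ t) :
    P.real (⋃ n ∈ Icc 1 t, {ω | √(2 * n * Real.log t) ≤ ∑ m ∈ range n, Y m ω})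
      ≤ 1 / (t : ℝ) ^ 2 := by
  have ht1 : (1 : ℝ) ≤ t := by exact_mod_cast ht
  have ht0 : (0 : ℝ) < t := by linarith
  have hlog := Real.log_natCast_nonneg t
  calc P.real (⋃ n ∈ Icc 1 t, {ω | √(2 * n * Real.log t) ≤ ∑ m ∈ range n, Y m ω})
      ≤ ∑ n ∈ Icc 1 t, P.real {ω | √(2 * n * Real.log t) ≤ ∑ m ∈ range n, Y m ω} :=
        measureReal_biUnion_finset_le _ _
    _ ≤ ∑ n ∈ Icc 1 t, 1 / (t : ℝ) ^ 4 := by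
        refine Finset.sum_le_sum fun n hn => ?_
        have hn0 : (0 : ℝ) < n := by exact_mod_cast (Finset.mem_Icc.1 hn).1
        refine (HasSubgaussianMGF.measure_sum_range_ge_le_of_iIndepFun hY
          (fun m _ => hsub m) (Real.sqrt_nonneg _)).trans_eq ?_
        rw [Real.sq_sqrt (by positivity)]
        have : -(2 * (n : ℝ) * Real.log t) / (2 * n * ((1 / 4 : NNReal) : ℝ))
            = -(4 * Real.log t) := by
          push_cast; field_simp
        rw [this, Real.exp_neg, one_div, show (4 : ℝ) = ((4 : ℕ) : ℝ) by norm_num,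
          Real.exp_nat_mul, Real.exp_log ht0]
    _ = 1 / (t : ℝ) ^ 3 := by
        rw [Finset.sum_const, Nat.card_Icc, nsmul_eq_mul, Nat.add_sub_cancel]
        field_simp
    _ ≤ 1 / (t : ℝ) ^ 2 := by
        gcongr
        norm_num

omit [IsProbabilityMeasure P] in
lemma IsBernoulliBandit.iIndepFun_comp (h : IsBernoulliBandit P μ X) (i : Fin k)
    {f : ℝ → ℝ} (hf : Measurable f) : iIndepFun (fun n => f ∘ X i n) P :=
  (h.indep.precomp (g := fun n : ℕ => (i, n)) fun _ _ hn => (Prod.mk.inj hn).2).comp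
    (fun _ => f) fun _ => hf

lemma IsBernoulliBandit.measureReal_exceeds_le (h : IsBernoulliBandit P μ X) (i : Fin k)
    {t : ℕ} (ht : 1 ≤ t) : P.real (exceeds μ X i t) ≤ 1 / (t : ℝ) ^ 2 :=
  measureReal_biUnion_sum_ge_le
    (h.iIndepFun_comp i (f := fun y => y - μ i) (by fun_prop)) (h.hasSubgaussianMGF i) ht

lemma IsBernoulliBandit.measureReal_fallsShort_le (h : IsBernoulliBandit P μ X) (i : Fin k)
    {t : ℕ} (ht : 1 ≤ t) : P.real (fallsShort μ X i t) ≤ 1 / (t : ℝ) ^ 2 := by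
  refine measureReal_biUnion_sum_ge_le
    (h.iIndepFun_comp i (f := fun y => μ i - y) (by fun_prop)) (fun n => ?_) ht
  convert (h.hasSubgaussianMGF i n).neg using 1
  ext ω
  simp

/-- The expected number of pulls of a suboptimal arm under Fair-UCB. -/
lemma IsBernoulliBandit.integral_pulls_le (h : IsBernoulliBandit P μ X)
    {r : Fin k → ℝ} {α : ℝ} {a : ℕ → Ω → Fin k} (ha : ∀ t, Measurable (a t))
    (hrun : ∀ ω, IsRun (fairLearn r α ucb1) (fun i n => X i n ω) (fun t => a t ω))
    {i j : Fin k} (hri : 0 ≤ r i) (hμ : (μ i : ℝ) < μ j) (T : ℕ) :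
    ∫ ω, (pulls (fun t => a t ω) i T : ℝ) ∂P ≤ max 0 ((⌊r i * (T : ℝ)⌋ : ℝ) - α) + 2
      + 8 * Real.log T / ((μ j : ℝ) - μ i) ^ 2 + 2 * ∑' s : ℕ, 1 / (s : ℝ) ^ 2 := by
  -- Measurable hulls make the indicators integrable at no cost in measure.
  set E : ℕ → Set Ω := fun t => toMeasurable P (exceeds μ X i t ∪ fallsShort μ X j t) with hE
  have hEm : ∀ t, MeasurableSet (E t) := fun t => measurableSet_toMeasurable _ _
  have hEP : ∀ t, 1 ≤ t → P.real (E t) ≤ 2 * (1 / (t : ℝ) ^ 2) := by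
    intro t ht
    rw [hE, measureReal_def, measure_toMeasurable, ← measureReal_def, two_mul]
    exact (measureReal_union_le _ _).trans
      (add_le_add (h.measureReal_exceeds_le i ht) (h.measureReal_fallsShort_le j ht))
  have hpt : ∀ ω, (pulls (fun t => a t ω) i T : ℝ) ≤ max 0 ((⌊r i * (T : ℝ)⌋ : ℝ) - α) + 2
      + 8 * Real.log T / ((μ j : ℝ) - μ i) ^ 2 + ∑ s ∈ Icc 1 T, (E s).indicator 1 ω := by
    intro ω
    refine pulls_le_of_isRun (hrun ω) hri (μ := fun l => (μ l : ℝ)) hμ (B := {s | ω ∈ E s})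
      (fun t ht hb n hn => ?_) le_rfl
    have hb' : ω ∉ exceeds μ X i t ∪ fallsShort μ X j t :=
      fun hω => hb (subset_toMeasurable P _ hω)
    simp only [exceeds, fallsShort, Set.mem_union, Set.mem_iUnion, Set.mem_ofPred_eq, not_or,
      not_exists, not_le] at hb'
    exact ⟨hb'.1 n hn, hb'.2 n hn⟩
  have hindint : ∀ s, Integrable ((E s).indicator (1 : Ω → ℝ)) P :=
    fun s => (integrable_const (1 : ℝ)).indicator (hEm s)
  have hint : Integrable (fun ω => (pulls (fun t => a t ω) i T : ℝ)) P := by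
    refine Integrable.of_bound (measurable_pulls ha i T).aestronglyMeasurable T
      (ae_of_all _ fun ω => ?_)
    rw [Real.norm_natCast]
    exact_mod_cast pulls_le _ i T
  have hsum : ∑ s ∈ Icc 1 T, P.real (E s) ≤ 2 * ∑' s : ℕ, 1 / (s : ℝ) ^ 2 := by
    calc ∑ s ∈ Icc 1 T, P.real (E s) ≤ ∑ s ∈ Icc 1 T, 2 * (1 / (s : ℝ) ^ 2) :=
          Finset.sum_le_sum fun s hs => hEP s (Finset.mem_Icc.1 hs).1
      _ ≤ 2 * ∑' s : ℕ, 1 / (s : ℝ) ^ 2 := by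
          rw [← Finset.mul_sum]
          gcongr
          exact (Real.summable_one_div_nat_pow.2 one_lt_two).sum_le_tsum _
            fun s _ => by positivity
  refine (integral_mono hint ((integrable_const _).add
    (integrable_finsetSum _ fun s _ => hindint s)) hpt).trans ?_
  simp only [Pi.add_apply]
  rw [integral_add (integrable_const _) (integrable_finsetSum _ fun s _ => hindint s),
    integral_finsetSum _ fun s _ => hindint s]
  simp only [integral_indicator_one (hEm _), integral_const, probReal_univ, one_smul]
  linarith

end Concentration

end FairMAB

open FairMAB in
theorem theorem3 (k : ℕ) (hk : 1 ≤ k) :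
    ∃ C : ℝ, 0 < C ∧
      ∀ (μ : Fin k → unitInterval) (r : Fin k → ℝ) (α : ℝ),
        (∀ i, 0 ≤ r i ∧ r i < 1 / (k : ℝ)) → 0 ≤ α →
        ∀ {Ω : Type*} [MeasurableSpace Ω] (P : Measure Ω) [IsProbabilityMeasure P]
          (X : Fin k → ℕ → Ω → ℝ), FairMAB.IsBernoulliBandit P μ X →
        ∀ a : ℕ → Ω → Fin k, (∀ t, Measurable (a t)) →
          (∀ ω, FairMAB.IsRun (FairMAB.fairLearn r α FairMAB.ucb1)
            (fun i n => X i n ω) (fun t => a t ω)) →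
        ∀ T : ℕ, 2 ≤ T →
          FairMAB.rRegret P μ r α a T ≤ C * Real.sqrt (T * Real.log T) := by
  have hK : 0 ≤ ∑' s : ℕ, 1 / (s : ℝ) ^ 2 := tsum_nonneg fun s => by positivity
  set K := ∑' s : ℕ, 1 / (s : ℝ) ^ 2 with hKdef
  have hk0 : (0 : ℝ) < k := by exact_mod_cast hk
  -- Per arm: 2 + 2K, using Δ ≤ 1 ≤ S, plus 8 from the logarithmic term.
  refine ⟨k * (10 + 2 * K), by positivity, ?_⟩
  intro μ r α hr hα Ω _ P _ X hX a ha hrun T hT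
  have : Nonempty (Fin k) := ⟨⟨0, hk⟩⟩
  obtain ⟨j, hj⟩ := exists_eq_ciSup_of_finite (f := fun j => (μ j : ℝ))
  have hT2 : (2 : ℝ) ≤ T := by exact_mod_cast hT
  have hT0 : (0 : ℝ) < T := by linarith
  have hlog : 1 / 2 ≤ Real.log T := by
    have := Real.log_le_log two_pos hT2
    linarith [Real.log_two_gt_d9]
  set S := √((T : ℝ) * Real.log T) with hS
  have hSsq : S ^ 2 = T * Real.log T := Real.sq_sqrt (by positivity)
  have hS1 : 1 ≤ S := by
    rw [hS, Real.one_le_sqrt]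
    nlinarith
  have harm : ∀ i, gap μ i * ((∫ ω, (pulls (fun t => a t ω) i T : ℝ) ∂P)
      - max 0 ((⌊r i * (T : ℝ)⌋ : ℝ) - α)) ≤ (10 + 2 * K) * S := by
    intro i
    have hgap : gap μ i = μ j - μ i := by rw [gap, ← hj]
    have hD0 : 0 ≤ gap μ i := by
      rw [gap, sub_nonneg]
      exact le_ciSup (f := fun j => (μ j : ℝ)) (Set.finite_range _).bddAbove i
    have hD1 : gap μ i ≤ 1 := by
      rw [hgap]; linarith [(μ j).2.2, (μ i).2.1]
    have hM := le_max_left 0 ((⌊r i * (T : ℝ)⌋ : ℝ) - α)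
    set D := gap μ i
    by_cases hsmall : D * T ≤ S
    · have hN : ∫ ω, (pulls (fun t => a t ω) i T : ℝ) ∂P ≤ T := by
        refine (integral_mono_of_nonneg (ae_of_all _ fun ω => Nat.cast_nonneg _)
          (integrable_const (T : ℝ)) (ae_of_all _ fun ω => ?_)).trans_eq (by simp)
        exact Nat.cast_le.2 (pulls_le _ i T)
      calc D * _ ≤ D * T := by gcongr; linarith
        _ ≤ S := hsmall
        _ ≤ (10 + 2 * K) * S := by nlinarith
    · push Not at hsmall
      have hDpos : 0 < D := by
        by_contra hD
        have : D = 0 := le_antisymm (not_lt.1 hD) hD0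
        rw [this, zero_mul] at hsmall
        linarith
      have hN := hX.integral_pulls_le ha hrun (hr i).1 (i := i) (j := j) (by linarith) T
      rw [← hgap] at hN
      have hL : D * (8 * Real.log T / D ^ 2) ≤ 8 * S := by
        rw [show D * (8 * Real.log T / D ^ 2) = 8 * Real.log T / D by field_simp,
          div_le_iff₀ hDpos]
        -- T log T = S² ≤ S · D T, since D T > S here.
        have : Real.log T * T ≤ S * D * T := by nlinarith
        have := le_of_mul_le_mul_right this hT0
        linarith
      calc D * _ ≤ D * (2 + 2 * K + 8 * Real.log T / D ^ 2) := by gcongr; linarith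
        _ = D * (2 + 2 * K) + D * (8 * Real.log T / D ^ 2) := by ring
        _ ≤ 1 * (2 + 2 * K) + 8 * S := by gcongr
        _ ≤ (10 + 2 * K) * S := by nlinarith
  calc rRegret P μ r α a T ≤ ∑ _i : Fin k, (10 + 2 * K) * S :=
        Finset.sum_le_sum fun i _ => harm i
    _ = k * (10 + 2 * K) * S := by simp [mul_assoc]
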